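/- **Game I.** Players $A_1,\dots,A_n$ ($n\ge1$) play one after another. A player starts with total $0$ and adds successive spins, which are independent and uniform on $[0,1]$ (also across players). A player with greed threshold $\tau\in[0,1]$ spins until the total exceeds $\tau$ for the first time; the score is this total if it is at most $1$, and $0$ otherwise. Each player knows the scores of the previous players and may choose the threshold according to them. A player wins if the score is positive and greater than the scores of all the other players (if all the scores are $0$, nobody wins). A policy is *optimal* if, after every list of scores of the previous players, the player whose turn it is uses a threshold in $[0,1]$ that maximizes that player's own winning probability among all thresholds in $[0,1]$, given that the later players follow the policy. Let $p(x)=1-e^x+xe^x$ and, for $n\ge 1$, let $\theta_n$ be the unique solution in $[0,1]$ of $p(x)^{n-1}=\int_x^1p(t)^{n-1}\,dt$. **Proposition.** The following policy is optimal: when $r$ players are still to play (the next one included) and $M$ is the maximum score of the players who have already played ($M=0$ if there are none), the next player uses the threshold $\max\{\theta_r,M\}$. Suppose that, for every $n\ge1$, the players of the $n$-player game follow an optimal policy. For $1\le m\le n$ let $P_n^m$ be the winning probability of player $A_m$ in the $n$-player game. For $1\le m\le r$ and $x\in[\theta_r,1]$ let $F_r^m(x)$ be the winning probability of player $A_{n-r+m}$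 in a game with $n>r$ players, given that the first $n-r$ players have obtained scores with maximum $x$. This probability depends only on $r$, $m$ and $x$ (not on $n$ or on the individual scores), and $F_r^m$ is integrable on $[\theta_r,1]$. For all $r\ge 1$, $1\le m\le r$ and $x\in[\theta_r,1]$, $$F_r^m(x)=\begin{cases} e^x\displaystyle\int_x^1 p(t)^{r-1}\,dt, & m=1,\\[1ex] p(x)\,F_{r-1}^{m-1}(x)+e^x\displaystyle\int_x^1F_{r-1}^{m-1}(t)\,dt, & m\ge2,\end{cases}$$ and for all $1\le m\le n$, $$P_n^m=\begin{cases} e^{\theta_n}\,p(\theta_n)^{n-1}, & m=1,\\[1ex] p(\theta_n)\,P_{n-1}^{m-1}+e^{\theta_n}\displaystyle\int_{\theta_n}^1F_{n-1}^{m-1}(t)\,dt, & m\ge2.\end{cases}$$ -/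

import Mathlib

open Set MeasureTheory

noncomputable section

namespace ShowcaseShowdown

/-! ### The constants of the game -/

/-- `p x = 1 - e ^ x + x e ^ x`. -/
def p (x : ℝ) : ℝ := 1 - Real.exp x + x * Real.exp x

theorem continuous_p : Continuous p := by unfold p; fun_prop

theorem p_zero : p 0 = 0 := by simp [p]

theorem p_one : p 1 = 1 := by simp [p]

theorem p_strictMonoOn : StrictMonoOn p (Icc 0 1) := by
  apply strictMonoOn_of_deriv_pos (convex_Icc 0 1) continuous_p.continuousOn
  intro x hx
  rw [interior_Icc] at hx
  have h : HasDerivAt p (0 - Real.exp x + (1 * Real.exp x + x * Real.exp x)) x :=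
    ((hasDerivAt_const x (1 : ℝ)).sub (Real.hasDerivAt_exp x)).add
      ((hasDerivAt_id x).mul (Real.hasDerivAt_exp x))
  rw [h.deriv]
  have := mul_pos hx.1 (Real.exp_pos x)
  linarith

theorem p_nonneg {x : ℝ} (hx : x ∈ Icc (0 : ℝ) 1) : 0 ≤ p x := by
  rw [← p_zero]
  exact p_strictMonoOn.monotoneOn (by simp) hx hx.1

/-- For every `n`, the equation `p x ^ (n - 1) = ∫_x^1 p t ^ (n - 1) dt` has exactly one solution
in `[0, 1]`. -/
theorem existsUnique_theta (n : ℕ) :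
    ∃! x : ℝ, x ∈ Icc (0 : ℝ) 1 ∧ p x ^ (n - 1) = ∫ t in x..1, p t ^ (n - 1) := by
  set k := n - 1
  have hc : Continuous fun t => p t ^ k := continuous_p.pow k
  have hi : ∀ a b : ℝ, IntervalIntegrable (fun t => p t ^ k) volume a b :=
    fun a b => hc.intervalIntegrable a b
  have hg : Continuous fun x : ℝ => ∫ t in x..1, p t ^ k := by
    have h1 : Continuous fun x : ℝ => -∫ t in (1 : ℝ)..x, p t ^ k :=
      (intervalIntegral.continuous_primitive hi 1).neg
    refine h1.congr fun x => ?_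
    rw [intervalIntegral.integral_symm x 1, neg_neg]
  have hnn : ∀ a b : ℝ, 0 ≤ a → a ≤ b → b ≤ 1 → 0 ≤ ∫ t in a..b, p t ^ k := fun a b h0 hab h1 =>
    intervalIntegral.integral_nonneg hab fun t ht =>
      pow_nonneg (p_nonneg ⟨h0.trans ht.1, ht.2.trans h1⟩) k
  have hpow : ∀ a b : ℝ, 0 ≤ a → a ≤ b → b ≤ 1 → p a ^ k ≤ p b ^ k := fun a b h0 hab h1 =>
    pow_le_pow_left₀ (p_nonneg ⟨h0, hab.trans h1⟩)
      (p_strictMonoOn.monotoneOn ⟨h0, hab.trans h1⟩ ⟨h0.trans hab, h1⟩ hab) k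
  -- No two different solutions.
  have huniq : ∀ a b : ℝ, 0 ≤ a → a < b → b ≤ 1 → p a ^ k = ∫ t in a..1, p t ^ k →
      p b ^ k = ∫ t in b..1, p t ^ k → False := by
    intro a b h0 hab h1 ha hb
    have hsplit := intervalIntegral.integral_add_adjacent_intervals (hi a b) (hi b 1)
    have hpos : 0 < ∫ t in a..b, p t ^ k := by
      refine intervalIntegral.intervalIntegral_pos_of_pos_on (hi a b) (fun t ht => ?_) hab
      have h0t : 0 < t := h0.trans_lt ht.1
      refine pow_pos ?_ k
      rw [← p_zero]
      exact p_strictMonoOn (by simp) ⟨h0t.le, ht.2.le.trans h1⟩ h0t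
    have := hpow a b h0 hab.le h1
    linarith
  have hex : ∃ x ∈ Icc (0 : ℝ) 1, p x ^ k - (∫ t in x..1, p t ^ k) = 0 := by
    have hcont : ContinuousOn (fun x : ℝ => p x ^ k - ∫ t in x..1, p t ^ k) (Icc 0 1) :=
      (hc.sub hg).continuousOn
    refine intermediate_value_Icc zero_le_one hcont ⟨?_, ?_⟩
    · rcases Nat.eq_zero_or_pos k with hk | hk
      · simp [hk]
      · have := hnn 0 1 le_rfl zero_le_one le_rfl
        simp only [p_zero, zero_pow hk.ne']
        linarith
    · simp [p_one]
  obtain ⟨x, hx, hx0⟩ := hex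
  refine ⟨x, ⟨hx, by linarith⟩, ?_⟩
  rintro y ⟨hy, hy0⟩
  rcases lt_trichotomy y x with h | h | h
  · exact (huniq y x hy.1 h hx.2 hy0 (by linarith)).elim
  · exact h
  · exact (huniq x y hx.1 h hy.2 (by linarith) hy0).elim

/-- `θ n` (for `n ≥ 1`) is the unique solution in `[0, 1]` of
`p x ^ (n - 1) = ∫_x^1 p t ^ (n - 1) dt`. -/
def θ (n : ℕ) : ℝ := (existsUnique_theta n).choose

/-! ### One player -/

/-- The running total after `k` spins, when the successive spins are `z 0, z 1, …`. -/
def total (z : ℕ → ℝ) (k : ℕ) : ℝ := ∑ i ∈ Finset.range k, z i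

open Classical in
/-- The final score of a player with greed threshold `τ` whose successive spins are `z 0, z 1, …`.
He spins until his running total is greater than `τ` for the first time; his score is this
total if it is at most `1`, and `0` otherwise (if the total never exceeds `τ`, which is an
event of probability zero, the score is set to `0`). -/
def score (τ : ℝ) (z : ℕ → ℝ) : ℝ :=
  if h : ∃ k, τ < total z k then
    if total z (Nat.find h) ≤ 1 then total z (Nat.find h) else 0
  else 0

/-- The uniform law on `[0, 1]`, the law of one spin. -/
def spinLaw : Measure ℝ := volume.restrict (Icc 0 1)

instance : IsProbabilityMeasure spinLaw := ⟨by simp [spinLaw]⟩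

/-- The joint law of the spins of `r` players: all spins are independent and uniform on `[0, 1]`.
Here `z i k` is spin number `k` of the player number `i` (both counted from `0`). -/
def spinsLaw (r : ℕ) : Measure (Fin r → ℕ → ℝ) :=
  Measure.pi fun _ => Measure.infinitePi fun _ : ℕ => spinLaw

/-! ### The sequential game -/

/-- The threshold strategies of all the players in one sequential game: each player knows the list
of the scores of the previous players (in order of play), and chooses his greed threshold
according to this list. The length of the list tells whose turn it is. -/
abbrev Profile : Type := List ℝ → ℝ

/-- The list of all final scores, if the scores `hist` have already been obtained, `r` players are
still to play, their spins are `z`, and they follow `σ`. -/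
def play (σ : Profile) : (r : ℕ) → (hist : List ℝ) → (z : Fin r → ℕ → ℝ) → List ℝ
  | 0, hist, _ => hist
  | r + 1, hist, z => play σ r (hist ++ [score (σ hist) (z 0)]) fun i => z i.succ

/-- Player number `m` (counted from `1`) wins with the final scores `s`: his score is positive and
greater than all the others. -/
def Wins (s : List ℝ) (m : ℕ) : Prop :=
  0 < s.getD (m - 1) 0 ∧ ∀ j < s.length, j ≠ m - 1 → s.getD j 0 < s.getD (m - 1) 0

/-- The probability that player `m` (counted from `1`) wins the game with `n` players, when the
first `hist.length` players have obtained the scores `hist` and all the others follow `σ`. -/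
def winProb (n : ℕ) (σ : Profile) (hist : List ℝ) (m : ℕ) : ℝ :=
  (spinsLaw (n - hist.length)).real {z | Wins (play σ (n - hist.length) hist z) m}

/-- The largest score obtained so far (`0` if nobody has played). -/
def maxScore (hist : List ℝ) : ℝ := hist.foldr max 0

open Classical in
/-- `σ` is an optimal policy for the game with `n` players: after every list of scores of the
previous players, the player whose turn it is uses a threshold in `[0, 1]` that maximizes his
probability of winning among all thresholds in `[0, 1]`, given that the later players
follow `σ`. -/
def IsOptimal (n : ℕ) (σ : Profile) : Prop :=
  ∀ hist : List ℝ, hist.length < n → (∀ s ∈ hist, s ∈ Icc (0 : ℝ) 1) →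
    σ hist ∈ Icc (0 : ℝ) 1 ∧
    ∀ τ ∈ Icc (0 : ℝ) 1,
      winProb n (Function.update σ hist τ) hist (hist.length + 1) ≤
        winProb n σ hist (hist.length + 1)

/-- The policy with thresholds `max (θ r) M`, where `r` is the number of players still to play
(the next one included) and `M` is the largest score of the previous players. -/
def maxPolicy (n : ℕ) : Profile := fun hist => max (θ (n - hist.length)) (maxScore hist)

end ShowcaseShowdown

end

noncomputable section

namespace ShowcaseShowdown

/-! ### Functions of the threshold -/

/-! The score of a player with threshold τ has an atom of mass `p τ` at 0 and density e^τ on (τ, 1]: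
the total of k spins is at most τ with probability τ^k / k!, and given that, the next total has
density 1 on (τ, 1]. Summing over k gives `map_score`.

Under the policy, thresholds are never below the current maximum, so each later player either busts
or takes the lead. A score s > 0 thus survives r later players exactly when all of them bust, with
probability G(s) = `probBelow r s`. Threshold τ against the maximum M wins with probability e^τ
∫_{max τ M}^1 G. As G is nondecreasing and positive on (0, 1], for M < 1 this has its only maximum
at max c M, where G(c) = ∫_c^1 G (`exp_mul_integral_lt`). Since θ is monotone, G = p^r on [θ_{r+1},
1], whence c = θ_{r+1}.

By backward induction this threshold is forced whenever M < 1 (`IsOptimal.eq_maxPolicy`). If M = 1,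
no remaining player can win, and such a history is almost surely not reached from one with M < 1.
Hence all optimal policies give the same winning probabilities `winValue`, which depend on the
history only through M. The recursions condition on the next score: a bust keeps M, any other score
replaces it. -/

theorem continuous_integral_to_one {G : ℝ → ℝ} (hG : Continuous G) :
    Continuous fun x : ℝ => ∫ t in x..1, G t := by
  have h1 : Continuous fun x : ℝ => -∫ t in (1 : ℝ)..x, G t :=
    (intervalIntegral.continuous_primitive (fun a b => hG.intervalIntegrable a b) 1).neg
  refine h1.congr fun x => ?_
  rw [intervalIntegral.integral_symm x 1, neg_neg]

theorem strictAntiOn_integral_to_one {G : ℝ → ℝ} (hG : Continuous G)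
    (hpos : ∀ x ∈ Ioc (0 : ℝ) 1, 0 < G x) :
    StrictAntiOn (fun x : ℝ => ∫ t in x..1, G t) (Icc 0 1) := by
  intro a ha b hb hab
  have hi : ∀ a b : ℝ, IntervalIntegrable G volume a b := fun a b => hG.intervalIntegrable a b
  have hsplit := intervalIntegral.integral_add_adjacent_intervals (hi a b) (hi b 1)
  have : 0 < ∫ t in a..b, G t :=
    intervalIntegral.intervalIntegral_pos_of_pos_on (hi a b)
      (fun t ht => hpos t ⟨ha.1.trans_lt ht.1, ht.2.le.trans hb.2⟩) hab
  simp only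
  linarith

theorem strictMonoOn_sub_integral {G : ℝ → ℝ} (hG : Continuous G) (hmono : MonotoneOn G (Icc 0 1))
    (hpos : ∀ x ∈ Ioc (0 : ℝ) 1, 0 < G x) :
    StrictMonoOn (fun x : ℝ => G x - ∫ t in x..1, G t) (Icc 0 1) := by
  intro a ha b hb hab
  have h1 := hmono ha hb hab.le
  have h2 := strictAntiOn_integral_to_one hG hpos ha hb hab
  simp only at h2 ⊢
  linarith

theorem hasDerivAt_exp_mul_integral {G : ℝ → ℝ} (hG : Continuous G) (x : ℝ) :
    HasDerivAt (fun x : ℝ => Real.exp x * ∫ t in x..1, G t)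
      (-(Real.exp x * (G x - ∫ t in x..1, G t))) x := by
  have h1 : HasDerivAt (fun x : ℝ => ∫ t in x..1, G t) (-G x) x :=
    intervalIntegral.integral_hasDerivAt_left (hG.intervalIntegrable _ _)
      hG.aestronglyMeasurable.stronglyMeasurableAtFilter hG.continuousAt
  refine ((Real.hasDerivAt_exp x).mul h1).congr_deriv ?_
  ring

/-- The winning probability `e ^ τ ∫_{max τ M}^1 G` as a function of the threshold `τ` has its
only maximum at `max c M`, where `c` is the root of `G c = ∫_c^1 G`. -/
theorem exp_mul_integral_lt {G : ℝ → ℝ} (hG : Continuous G) (hmono : MonotoneOn G (Icc 0 1))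
    (hpos : ∀ x ∈ Ioc (0 : ℝ) 1, 0 < G x) {c M τ : ℝ} (hc : c ∈ Icc (0 : ℝ) 1)
    (hcG : G c = ∫ t in c..1, G t) (hM : 0 ≤ M) (hM1 : M < 1) (hτ : τ ∈ Icc (0 : ℝ) 1)
    (hne : τ ≠ max c M) :
    (Real.exp τ * ∫ t in (max τ M)..1, G t) <
      Real.exp (max c M) * ∫ t in (max c M)..1, G t := by
  set g : ℝ → ℝ := fun x => Real.exp x * ∫ t in x..1, G t with hg
  have hgc : Continuous g := Real.continuous_exp.mul (continuous_integral_to_one hG)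
  have hh := strictMonoOn_sub_integral hG hmono hpos
  -- The derivative of `g` is -e^x (G x - ∫_x^1 G). The bracket is strictly increasing and vanishes
  -- at `c`, so `g` rises before `c` and falls after it.
  have hinc : StrictMonoOn g (Icc 0 c) := by
    apply strictMonoOn_of_deriv_pos (convex_Icc 0 c) hgc.continuousOn
    intro x hx
    rw [interior_Icc] at hx
    rw [(hasDerivAt_exp_mul_integral hG x).deriv]
    have h1 := hh ⟨hx.1.le, hx.2.le.trans hc.2⟩ hc hx.2
    simp only [hcG, sub_self] at h1
    have := mul_neg_of_pos_of_neg (Real.exp_pos x) h1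
    linarith
  have hdec : StrictAntiOn g (Icc c 1) := by
    apply strictAntiOn_of_deriv_neg (convex_Icc c 1) hgc.continuousOn
    intro x hx
    rw [interior_Icc] at hx
    rw [(hasDerivAt_exp_mul_integral hG x).deriv]
    have h1 := hh hc ⟨hc.1.trans hx.1.le, hx.2.le⟩ hx.1
    simp only [hcG, sub_self] at h1
    have := mul_pos (Real.exp_pos x) h1
    linarith
  -- Below `M` the integral does not depend on `τ`, so raising the threshold to `M` only enlarges
  -- the factor e^τ.
  rcases lt_or_ge τ M with h | h
  · rw [max_eq_right h.le]
    have hI : 0 < ∫ t in M..1, G t := by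
      simpa using strictAntiOn_integral_to_one hG hpos ⟨hM, hM1.le⟩ (right_mem_Icc.2 zero_le_one)
        hM1
    have h1 : Real.exp τ * ∫ t in M..1, G t < g M :=
      mul_lt_mul_of_pos_right (Real.exp_lt_exp.2 h) hI
    refine h1.trans_le ?_
    rcases le_total c M with h2 | h2
    · rw [max_eq_right h2]
    · rw [max_eq_left h2]
      exact hinc.monotoneOn ⟨hM, h2⟩ ⟨hc.1, le_rfl⟩ h2
  · rw [max_eq_left h]
    rcases lt_or_gt_of_ne hne with h2 | h2
    · rcases lt_max_iff.1 h2 with h3 | h3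
      · rw [max_eq_left (h.trans h3.le)]
        exact hinc ⟨hτ.1, h3.le⟩ ⟨hc.1, le_rfl⟩ h3
      · exact absurd h3 (not_lt.2 h)
    · exact hdec ⟨le_max_left _ _, h2.le.trans hτ.2⟩ ⟨(le_max_left _ _).trans h2.le, hτ.2⟩ h2

/-! ### The constants `θ n` -/

theorem theta_mem (n : ℕ) : θ n ∈ Icc (0 : ℝ) 1 := (existsUnique_theta n).choose_spec.1.1

theorem theta_spec (n : ℕ) : p (θ n) ^ (n - 1) = ∫ t in (θ n)..1, p t ^ (n - 1) :=
  (existsUnique_theta n).choose_spec.1.2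

theorem p_pos {x : ℝ} (hx : x ∈ Ioc (0 : ℝ) 1) : 0 < p x := by
  rw [← p_zero]
  exact p_strictMonoOn (by simp) ⟨hx.1.le, hx.2⟩ hx.1

theorem monotoneOn_p_pow (k : ℕ) : MonotoneOn (fun x => p x ^ k) (Icc 0 1) := fun _ ha _ hb hab =>
  pow_le_pow_left₀ (p_nonneg ha) (p_strictMonoOn.monotoneOn ha hb hab) k

/-- For n ≥ 1 put a = θ n. Multiplying the equation for a by p a, and using p a ≤ p t for t ≥ a,
gives p(a)^n ≤ ∫_a^1 p^n. The difference of the two sides is strictly increasing in a and vanishes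
at θ (n + 1). -/
theorem theta_le_succ (n : ℕ) : θ n ≤ θ (n + 1) := by
  rcases Nat.eq_zero_or_pos n with rfl | hn
  -- With truncated subtraction, `θ 0` and `θ 1` have the same defining equation.
  · exact le_of_eq rfl
  obtain ⟨k, rfl⟩ : ∃ k, n = k + 1 := ⟨n - 1, by omega⟩
  by_contra! hlt
  have ha := theta_mem (k + 1)
  have h := strictMonoOn_sub_integral (G := fun x => p x ^ (k + 1)) (continuous_p.pow (k + 1)) (monotoneOn_p_pow (k + 1))
    (fun x hx => pow_pos (p_pos hx) _) (theta_mem (k + 1 + 1)) ha hlt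
  have hb := theta_spec (k + 1 + 1)
  have hspec := theta_spec (k + 1)
  simp only [Nat.add_sub_cancel] at hb hspec
  simp only [hb, sub_self, sub_pos] at h
  refine absurd h (not_lt.2 ?_)
  rw [pow_succ', hspec, ← intervalIntegral.integral_const_mul]
  refine intervalIntegral.integral_mono_on ha.2
    ((continuous_const.mul (continuous_p.pow k)).intervalIntegrable _ _)
    ((continuous_p.pow (k + 1)).intervalIntegrable _ _) fun t ht => ?_
  have ht' : t ∈ Icc (0 : ℝ) 1 := ⟨ha.1.trans ht.1, ht.2⟩
  rw [pow_succ']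
  exact mul_le_mul_of_nonneg_right (p_strictMonoOn.monotoneOn ha ht' ht.1)
    (pow_nonneg (p_nonneg ht') k)

theorem monotone_theta : Monotone θ := monotone_nat_of_le_succ theta_le_succ

theorem max_theta_mem (n : ℕ) {M : ℝ} (hM : M ≤ 1) : max (θ n) M ∈ Icc (0 : ℝ) 1 :=
  ⟨(theta_mem n).1.trans (le_max_left _ _), max_le (theta_mem n).2 hM⟩

/-! ### The winning probabilities as functions of the current maximum -/

/-- The probability that `r` players who follow the policy with thresholds `max (θ j) s` all have
scores less than the current maximum `s > 0`. -/
def probBelow (r : ℕ) (s : ℝ) : ℝ := ∏ i : Fin r, p (max (θ (r - i)) s)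

theorem continuous_probBelow (r : ℕ) : Continuous (probBelow r) :=
  continuous_finsetProd _ fun _ _ => continuous_p.comp (continuous_const.max continuous_id)

theorem probBelow_pos (r : ℕ) {s : ℝ} (hs : s ∈ Ioc (0 : ℝ) 1) : 0 < probBelow r s :=
  Finset.prod_pos fun _ _ => p_pos ⟨hs.1.trans_le (le_max_right _ _), (max_theta_mem _ hs.2).2⟩

theorem probBelow_nonneg (r : ℕ) {s : ℝ} (hs : s ≤ 1) : 0 ≤ probBelow r s :=
  Finset.prod_nonneg fun _ _ => p_nonneg (max_theta_mem _ hs)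

theorem monotoneOn_probBelow (r : ℕ) : MonotoneOn (probBelow r) (Icc 0 1) := fun _ ha _ hb hab =>
  Finset.prod_le_prod (fun _ _ => p_nonneg (max_theta_mem _ ha.2)) fun _ _ =>
    p_strictMonoOn.monotoneOn (max_theta_mem _ ha.2) (max_theta_mem _ hb.2)
      (max_le_max le_rfl hab)

/-- By monotonicity of `θ`, all later players then have the threshold `s` itself. -/
theorem probBelow_eq_pow {r : ℕ} {s : ℝ} (hs : θ (r + 1) ≤ s) : probBelow r s = p s ^ r := by
  have h : ∀ i : Fin r, p (max (θ (r - i)) s) = p s := fun i => by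
    rw [max_eq_right ((monotone_theta (by omega)).trans hs)]
  simp [probBelow, h]

theorem integral_probBelow {r : ℕ} {x : ℝ} (hx : x ∈ Icc (θ (r + 1)) 1) :
    ∫ t in x..1, probBelow r t = ∫ t in x..1, p t ^ r := by
  refine intervalIntegral.integral_congr fun t ht => ?_
  rw [uIcc_of_le hx.2] at ht
  exact probBelow_eq_pow (hx.1.trans ht.1)

/-- The critical equation for `probBelow r` only involves values on [θ (r + 1), 1], where it is the
equation defining θ (r + 1). -/
theorem probBelow_theta (r : ℕ) :
    probBelow r (θ (r + 1)) = ∫ t in (θ (r + 1))..1, probBelow r t := by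
  rw [integral_probBelow ⟨le_rfl, (theta_mem _).2⟩, probBelow_eq_pow le_rfl]
  exact theta_spec (r + 1)

/-- The winning probability of player number `m` (counted from `0`) among the `r` players still to
play, if the current maximum is `M` and they follow the policy with thresholds `max (θ j) M`. -/
def winValue : ℕ → ℕ → ℝ → ℝ
  | 0, _, _ => 0
  | r + 1, 0, M =>
    Real.exp (max (θ (r + 1)) M) * ∫ t in (max (θ (r + 1)) M)..1, probBelow r t
  -- A bust of the next player leaves the maximum at `M`; any other score `t` exceeds `M` and
  -- becomes the maximum.
  | r + 1, m + 1, M =>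
    p (max (θ (r + 1)) M) * winValue r m M +
      Real.exp (max (θ (r + 1)) M) * ∫ t in (max (θ (r + 1)) M)..1, winValue r m t

theorem continuous_winValue (r m : ℕ) : Continuous (winValue r m) := by
  induction r generalizing m with
  | zero => exact continuous_const
  | succ r ih =>
    have hmax : Continuous fun M : ℝ => max (θ (r + 1)) M := continuous_const.max continuous_id
    cases m with
    | zero =>
      exact (Real.continuous_exp.comp hmax).mul
        ((continuous_integral_to_one (continuous_probBelow r)).comp hmax)
    | succ m =>
      exact ((continuous_p.comp hmax).mul (ih m)).add ((Real.continuous_exp.comp hmax).mul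
        ((continuous_integral_to_one (ih m)).comp hmax))

theorem winValue_nonneg (r m : ℕ) {M : ℝ} (hM : M ≤ 1) : 0 ≤ winValue r m M := by
  induction r generalizing m M with
  | zero => exact le_rfl
  | succ r ih =>
    cases m with
    | zero =>
      exact mul_nonneg (Real.exp_pos _).le (intervalIntegral.integral_nonneg
        (max_theta_mem _ hM).2 fun t ht => probBelow_nonneg r ht.2)
    | succ m =>
      exact add_nonneg (mul_nonneg (p_nonneg (max_theta_mem _ hM)) (ih m hM))
        (mul_nonneg (Real.exp_pos _).le (intervalIntegral.integral_nonneg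
          (max_theta_mem _ hM).2 fun t ht => ih m ht.2))

/-- Keeps the formula valid at maximum 1, where optimal thresholds are arbitrary but nobody can win
any more. -/
theorem winValue_one (r m : ℕ) : winValue r m 1 = 0 := by
  induction r generalizing m with
  | zero => rfl
  | succ r ih => cases m <;> simp [winValue, max_eq_right (theta_mem (r + 1)).2, ih]

/-! ### Scores and histories -/

/-- With a threshold at least the current maximum, this is the dichotomy between going bust and
taking the lead. -/
theorem score_mem (τ : ℝ) (z : ℕ → ℝ) : score τ z = 0 ∨ score τ z ∈ Ioc τ 1 := by
  unfold score
  split_ifs with h h1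
  · exact Or.inr ⟨Nat.find_spec h, h1⟩
  · exact Or.inl rfl
  · exact Or.inl rfl

theorem score_le_one (τ : ℝ) (z : ℕ → ℝ) : score τ z ≤ 1 := by
  rcases score_mem τ z with h | h
  · exact h.le.trans zero_le_one
  · exact h.2

theorem score_nonneg {τ : ℝ} (hτ : 0 ≤ τ) (z : ℕ → ℝ) : 0 ≤ score τ z := by
  rcases score_mem τ z with h | h
  · exact h.ge
  · exact hτ.trans h.1.le

theorem score_mem_Icc {τ : ℝ} (hτ : 0 ≤ τ) (z : ℕ → ℝ) : score τ z ∈ Icc (0 : ℝ) 1 :=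
  ⟨score_nonneg hτ z, score_le_one τ z⟩

theorem score_ne_one {z : ℕ → ℝ} (hz : ∀ k, total z k ≠ 1) (τ : ℝ) : score τ z ≠ 1 := by
  unfold score
  split_ifs
  · exact hz _
  · exact zero_ne_one
  · exact zero_ne_one

theorem maxScore_append (L : List ℝ) (s : ℝ) :
    maxScore (L ++ [s]) = max (maxScore L) (max s 0) := by
  induction L with
  | nil => simp [maxScore]
  | cons a L ih => simpa [maxScore, max_assoc] using congrArg (max a) ih

theorem maxScore_append_of_nonneg (L : List ℝ) {s : ℝ} (hs : 0 ≤ s) :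
    maxScore (L ++ [s]) = max (maxScore L) s := by
  rw [maxScore_append, max_eq_left hs]

theorem maxScore_nonneg (L : List ℝ) : 0 ≤ maxScore L := by
  induction L with
  | nil => exact le_rfl
  | cons a L ih => exact ih.trans (le_max_right _ _)

theorem maxScore_lt_iff {L : List ℝ} {s : ℝ} : maxScore L < s ↔ 0 < s ∧ ∀ a ∈ L, a < s := by
  induction L with
  | nil => simp [maxScore]
  | cons a L ih =>
    have : maxScore (a :: L) = max a (maxScore L) := rfl
    rw [this, max_lt_iff, ih]
    simp only [List.mem_cons, forall_eq_or_imp]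
    tauto

theorem le_maxScore {L : List ℝ} {a : ℝ} (ha : a ∈ L) : a ≤ maxScore L := by
  by_contra! h
  exact lt_irrefl _ ((maxScore_lt_iff.1 h).2 a ha)

theorem maxScore_le_one {L : List ℝ} (hL : ∀ s ∈ L, s ∈ Icc (0 : ℝ) 1) : maxScore L ≤ 1 := by
  refine le_of_forall_gt fun c hc => maxScore_lt_iff.2 ⟨zero_lt_one.trans hc, fun a ha => ?_⟩
  exact (hL a ha).2.trans_lt hc

theorem mem_Icc_append {L : List ℝ} (hL : ∀ s ∈ L, s ∈ Icc (0 : ℝ) 1) {s : ℝ}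
    (hs : s ∈ Icc (0 : ℝ) 1) : ∀ a ∈ L ++ [s], a ∈ Icc (0 : ℝ) 1 := by
  intro a ha
  rcases List.mem_append.1 ha with h | h
  · exact hL a h
  · rw [List.mem_singleton.1 h]; exact hs

/-! ### Winning -/

theorem maxScore_eq_of_wins {L : List ℝ} {j : ℕ} (h : Wins L (j + 1)) :
    maxScore L = L.getD j 0 := by
  obtain ⟨h0, h1⟩ := h
  simp only [Nat.add_sub_cancel] at h0 h1
  have hj : j < L.length := by
    by_contra! hj
    rw [List.getD_eq_default _ _ hj] at h0
    exact lt_irrefl _ h0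
  refine le_antisymm (le_of_forall_gt fun c hc => ?_) (le_maxScore ?_)
  · refine maxScore_lt_iff.2 ⟨h0.trans hc, fun a ha => ?_⟩
    obtain ⟨i, hi, rfl⟩ := List.getElem_of_mem ha
    rcases eq_or_ne i j with rfl | hij
    · rwa [List.getD_eq_getElem _ _ hj] at hc
    · have := h1 i hi hij
      rw [List.getD_eq_getElem _ _ hi] at this
      exact this.trans hc
  · rw [List.getD_eq_getElem _ _ hj]
    exact List.getElem_mem hj

theorem wins_append_iff {L : List ℝ} {j : ℕ} (hj : j < L.length) (s : ℝ) :
    Wins (L ++ [s]) (j + 1) ↔ Wins L (j + 1) ∧ s < L.getD j 0 := by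
  have hlast : (L ++ [s]).getD L.length 0 = s := by simp
  unfold Wins
  simp only [Nat.add_sub_cancel, List.length_append, List.length_singleton,
    List.getD_append L [s] 0 j hj]
  constructor
  · rintro ⟨h0, h1⟩
    refine ⟨⟨h0, fun i hi hij => ?_⟩, ?_⟩
    · simpa only [List.getD_append L [s] 0 i hi] using h1 i (by omega) hij
    · simpa only [hlast] using h1 L.length (by omega) (by omega)
  · rintro ⟨⟨h0, h1⟩, h2⟩
    refine ⟨h0, fun i hi hij => ?_⟩
    rcases Nat.lt_or_ge i L.length with h | h
    · simpa only [List.getD_append L [s] 0 i h] using h1 i h hij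
    · obtain rfl : i = L.length := by omega
      rwa [hlast]

theorem wins_last_iff (L : List ℝ) (s : ℝ) :
    Wins (L ++ [s]) (L.length + 1) ↔ maxScore L < s := by
  have hlast : (L ++ [s]).getD L.length 0 = s := by simp
  rw [maxScore_lt_iff]
  unfold Wins
  simp only [Nat.add_sub_cancel, List.length_append, List.length_singleton, hlast]
  refine and_congr_right fun _ => ⟨fun h a ha => ?_, fun h i hi hij => ?_⟩
  · obtain ⟨i, hi, rfl⟩ := List.getElem_of_mem ha
    have := h i (by omega) (by omega)
    rwa [List.getD_append L [s] 0 i hi, List.getD_eq_getElem _ _ hi] at this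
  · have hi' : i < L.length := by omega
    rw [List.getD_append L [s] 0 i hi', List.getD_eq_getElem _ _ hi']
    exact h _ (List.getElem_mem hi')

/-! ### Plays -/

theorem play_congr {σ σ' : Profile} {r : ℕ} {L : List ℝ}
    (h : ∀ L' : List ℝ, L.length ≤ L'.length → σ L' = σ' L') (z : Fin r → ℕ → ℝ) :
    play σ r L z = play σ' r L z := by
  induction r generalizing L with
  | zero => rfl
  | succ r ih =>
    simp only [play, h L le_rfl]
    refine ih (fun L' hL' => h L' ?_) _
    simp only [List.length_append, List.length_singleton] at hL'
    omega

/-- Later histories are longer than `L`, so a deviation at `L` changes one player's threshold only.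
-/
theorem play_update (σ : Profile) (r : ℕ) (L : List ℝ) (τ : ℝ) (z : Fin (r + 1) → ℕ → ℝ) :
    play (Function.update σ L τ) (r + 1) L z =
      play σ r (L ++ [score τ (z 0)]) fun i => z i.succ := by
  simp only [play, Function.update_self]
  refine play_congr (fun L' hL' => Function.update_of_ne ?_ _ _) _
  rintro rfl
  simp at hL'

/-- If no total is exactly `1`, then only the histories with a maximum less than `1` matter. -/
theorem play_congr_of_ne_one {n : ℕ} {σ σ' : Profile} {r : ℕ} {L : List ℝ}
    (hn : L.length + r = n) (hL : ∀ s ∈ L, s ∈ Icc (0 : ℝ) 1) (hL1 : maxScore L < 1)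
    (h : ∀ L' : List ℝ, L <+: L' → L'.length < n → (∀ s ∈ L', s ∈ Icc (0 : ℝ) 1) →
      maxScore L' < 1 → 0 ≤ σ L' ∧ σ L' = σ' L')
    {z : Fin r → ℕ → ℝ} (hz : ∀ i k, total (z i) k ≠ 1) :
    play σ r L z = play σ' r L z := by
  induction r generalizing L with
  | zero => rfl
  | succ r ih =>
    obtain ⟨h0, h1⟩ := h L List.prefix_rfl (by omega) hL hL1
    have hs := score_mem_Icc h0 (z 0)
    simp only [play, ← h1]
    refine ih (by simp; omega) (mem_Icc_append hL hs) ?_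
      (fun L' hL' => h L' ((List.prefix_append _ _).trans hL')) (fun i k => hz i.succ k)
    rw [maxScore_append_of_nonneg _ hs.1]
    exact max_lt hL1 (lt_of_le_of_ne hs.2 (score_ne_one (hz 0) _))

theorem exists_play_eq (σ : Profile) (r : ℕ) (L : List ℝ) (z : Fin r → ℕ → ℝ) :
    ∃ L' : List ℝ, play σ r L z = L ++ L' ∧ ∀ s ∈ L', s ≤ 1 := by
  induction r generalizing L with
  | zero => exact ⟨[], by simp [play], by simp⟩
  | succ r ih =>
    obtain ⟨L', h, h1⟩ := ih (L ++ [score (σ L) (z 0)]) fun i => z i.succ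
    refine ⟨score (σ L) (z 0) :: L', by simp [play, h], ?_⟩
    intro s hs
    rcases List.mem_cons.1 hs with rfl | hs
    · exact score_le_one _ _
    · exact h1 s hs

/-- A win would need a score above 1, whatever the thresholds. -/
theorem not_wins_of_maxScore_eq_one (σ : Profile) (r m : ℕ) {L : List ℝ} (hL : maxScore L = 1)
    (z : Fin r → ℕ → ℝ) : ¬ Wins (play σ r L z) (L.length + m + 1) := by
  obtain ⟨L', h, h1⟩ := exists_play_eq σ r L z
  rw [h]
  intro hw
  obtain ⟨h2, h3⟩ := hw
  simp only [Nat.add_sub_cancel] at h2 h3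
  have hle : (L ++ L').getD (L.length + m) 0 ≤ 1 := by
    rw [List.getD_append_right _ _ _ _ (by omega)]
    rcases Nat.lt_or_ge (L.length + m - L.length) L'.length with h4 | h4
    · rw [List.getD_eq_getElem _ _ h4]
      exact h1 _ (List.getElem_mem h4)
    -- `m` is not bounded by `r`; beyond the end of the list the score defaults to 0.
    · rw [List.getD_eq_default _ _ h4]
      exact zero_le_one
  have hlt : maxScore L < (L ++ L').getD (L.length + m) 0 := by
    refine maxScore_lt_iff.2 ⟨h2, fun a ha => ?_⟩
    obtain ⟨i, hi, rfl⟩ := List.getElem_of_mem ha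
    have := h3 i (by simp; omega) (by omega)
    rwa [List.getD_append _ _ _ _ hi, List.getD_eq_getElem _ _ hi] at this
  rw [hL] at hlt
  exact absurd hlt (not_lt.2 hle)

/-- The event that `r` players with the thresholds `max (θ j) s` all have scores less than `s`. -/
def belowEvent (r : ℕ) (s : ℝ) : Set (Fin r → ℕ → ℝ) :=
  {z | ∀ i : Fin r, score (max (θ (r - i)) s) (z i) < s}

theorem mem_belowEvent_succ {r : ℕ} {s : ℝ} {z : Fin (r + 1) → ℕ → ℝ} :
    z ∈ belowEvent (r + 1) s ↔
      score (max (θ (r + 1)) s) (z 0) < s ∧ (fun i => z i.succ) ∈ belowEvent r s := by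
  simp [belowEvent, Fin.forall_fin_succ]

/-- The event that the next player, who uses the threshold `τ`, wins against `r` later players. -/
def nextEvent (r : ℕ) (τ M : ℝ) : Set (Fin (r + 1) → ℕ → ℝ) :=
  {z | M < score τ (z 0) ∧ (fun i => z i.succ) ∈ belowEvent r (score τ (z 0))}

/-- The event that player number `m` (counted from `0`) of the `r` players still to play wins, if
the current maximum is `M` and all of them follow the policy with thresholds `max (θ j) M`. -/
def winEvent : (r m : ℕ) → ℝ → Set (Fin r → ℕ → ℝ)
  | 0, _, _ => ∅
  | r + 1, 0, M => nextEvent r (max (θ (r + 1)) M) M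
  | r + 1, m + 1, M =>
    {z | (fun i => z i.succ) ∈ winEvent r m (max M (score (max (θ (r + 1)) M) (z 0)))}

theorem maxPolicy_eq {n r : ℕ} {L : List ℝ} (hn : L.length + r = n) :
    maxPolicy n L = max (θ r) (maxScore L) := by
  rw [maxPolicy, ← hn, Nat.add_sub_cancel_left]

theorem maxPolicy_nonneg (n : ℕ) (L : List ℝ) : 0 ≤ maxPolicy n L :=
  (maxScore_nonneg L).trans (le_max_right _ _)

/-- While the leader is unbeaten the maximum stays `maxScore L`, so the later thresholds can be
frozen at values independent of the intermediate scores. This makes the conditions on the later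
players independent. -/
theorem wins_play_iff_belowEvent {n r : ℕ} {L : List ℝ} (hn : L.length + r = n) {j : ℕ}
    (hj : j < L.length) (z : Fin r → ℕ → ℝ) :
    Wins (play (maxPolicy n) r L z) (j + 1) ↔
      Wins L (j + 1) ∧ z ∈ belowEvent r (maxScore L) := by
  induction r generalizing L with
  | zero => simp [play, belowEvent]
  | succ r ih =>
    have hs := score_nonneg (maxPolicy_nonneg n L) (z 0)
    rw [play, ih (by simp; omega) (by simp; omega), wins_append_iff hj, mem_belowEvent_succ,
      maxScore_append_of_nonneg _ hs, maxPolicy_eq hn, and_assoc]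
    refine and_congr_right fun hw => ?_
    rw [← maxScore_eq_of_wins hw]
    refine and_congr_right fun hlt => ?_
    rw [max_eq_left hlt.le]

theorem wins_play_append_iff {n r : ℕ} {L : List ℝ} (hn : L.length + (r + 1) = n) (s : ℝ)
    (z : Fin r → ℕ → ℝ) :
    Wins (play (maxPolicy n) r (L ++ [s]) z) (L.length + 1) ↔
      maxScore L < s ∧ z ∈ belowEvent r s := by
  rw [wins_play_iff_belowEvent (by simp; omega) (by simp), wins_last_iff]
  refine and_congr_right fun h => ?_
  rw [maxScore_append_of_nonneg _ ((maxScore_nonneg L).trans h.le), max_eq_right h.le]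

theorem wins_play_iff_winEvent {n r : ℕ} {L : List ℝ} (hn : L.length + r = n) {m : ℕ} (hm : m < r)
    (z : Fin r → ℕ → ℝ) :
    Wins (play (maxPolicy n) r L z) (L.length + m + 1) ↔ z ∈ winEvent r m (maxScore L) := by
  induction r generalizing L m with
  | zero => omega
  | succ r ih =>
    have hs := score_nonneg (maxPolicy_nonneg n L) (z 0)
    rw [play]
    cases m with
    | zero =>
      have h := wins_play_append_iff hn (score (maxPolicy n L) (z 0)) fun i => z i.succ
      rw [maxPolicy_eq hn] at h ⊢
      exact h
    | succ m =>
      have h := @ih (L ++ [score (maxPolicy n L) (z 0)]) (by simp; omega) m (by omega)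
        fun i => z i.succ
      have hlen : (L ++ [score (maxPolicy n L) (z 0)]).length + m + 1 =
          L.length + (m + 1) + 1 := by
        simp; omega
      rw [hlen, maxScore_append_of_nonneg _ hs, maxPolicy_eq hn] at h
      rw [maxPolicy_eq hn]
      exact h

/-! ### The law of the totals -/

/-- The law of the spins of one player. -/
def spinSeqLaw : Measure (ℕ → ℝ) := Measure.infinitePi fun _ : ℕ => spinLaw

instance : IsProbabilityMeasure spinSeqLaw := by unfold spinSeqLaw; infer_instance

theorem measurable_total (k : ℕ) : Measurable fun z => total z k :=
  Finset.measurable_sum _ fun i _ => measurable_pi_apply i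

theorem total_succ (z : ℕ → ℝ) (k : ℕ) : total z (k + 1) = total z k + z k :=
  Finset.sum_range_succ _ _

theorem monotone_total {z : ℕ → ℝ} (hz : ∀ i, 0 ≤ z i) : Monotone (total z) :=
  monotone_nat_of_le_succ fun k => by rw [total_succ]; linarith [hz k]

theorem total_nonneg {z : ℕ → ℝ} (hz : ∀ i, 0 ≤ z i) (k : ℕ) : 0 ≤ total z k :=
  Finset.sum_nonneg fun i _ => hz i

theorem ae_spin_nonneg : ∀ᵐ z ∂spinSeqLaw, ∀ i, 0 ≤ z i := by
  refine ae_all_iff.2 fun i => ?_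
  have h : ∀ᵐ x ∂spinLaw, 0 ≤ x := by
    filter_upwards [ae_restrict_mem measurableSet_Icc] with x hx using hx.1
  exact (measurePreserving_eval_infinitePi (fun _ : ℕ => spinLaw) i).quasiMeasurePreserving.ae h

/-- The total of the first `k` spins is independent of the next spin. Fubini in one order handles
the crossing of the threshold, in the other the law of the totals. -/
theorem map_total_prod (k : ℕ) :
    spinSeqLaw.map (fun z => (total z k, z k)) =
      (spinSeqLaw.map fun z => total z k).prod spinLaw := by
  have hind : ProbabilityTheory.iIndepFun (fun (i : ℕ) (z : ℕ → ℝ) => z i) spinSeqLaw :=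
    ProbabilityTheory.iIndepFun_infinitePi (P := fun _ : ℕ => spinLaw)
      (X := fun _ x => x) fun _ => measurable_id
  have h := hind.indepFun_sum_range_succ (fun i => measurable_pi_apply i) k
  have heq : (∑ j ∈ Finset.range k, fun z : ℕ → ℝ => z j) = fun z => total z k := by
    ext z
    simp [total]
  rw [heq] at h
  rw [h.map_prod_eq_prod_map_map (measurable_total k).aemeasurable
    (measurable_pi_apply k).aemeasurable]
  congr 1
  exact (measurePreserving_eval_infinitePi (fun _ : ℕ => spinLaw) k).map_eq

theorem measure_total_spin (k : ℕ) {S : Set (ℝ × ℝ)} (hS : MeasurableSet S) :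
    spinSeqLaw {z | (total z k, z k) ∈ S} =
      ∫⁻ z, spinLaw {x | (total z k, x) ∈ S} ∂spinSeqLaw := by
  have hm := (measurable_total k).prodMk (measurable_pi_apply k)
  have h := Measure.map_apply (μ := spinSeqLaw) hm hS
  rw [map_total_prod, Measure.prod_apply hS,
    lintegral_map (measurable_measure_prodMk_left hS) (measurable_total k)] at h
  exact h.symm

theorem measure_total_spin_symm (k : ℕ) {S : Set (ℝ × ℝ)} (hS : MeasurableSet S) :
    spinSeqLaw {z | (total z k, z k) ∈ S} =
      ∫⁻ x, spinSeqLaw {z | (total z k, x) ∈ S} ∂spinLaw := by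
  have hm := (measurable_total k).prodMk (measurable_pi_apply k)
  have h := Measure.map_apply (μ := spinSeqLaw) hm hS
  have : IsProbabilityMeasure (spinSeqLaw.map fun z => total z k) :=
    Measure.isProbabilityMeasure_map (measurable_total k).aemeasurable
  rw [map_total_prod, Measure.prod_apply_symm hS] at h
  refine h.symm.trans (lintegral_congr fun x => ?_)
  rw [Measure.map_apply (measurable_total k) (measurable_prodMk_right hS)]
  rfl

theorem measure_total_le_of_neg (k : ℕ) {t : ℝ} (ht : t < 0) :
    spinSeqLaw {z | total z k ≤ t} = 0 := by
  refine measure_eq_zero_iff_ae_notMem.2 ?_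
  filter_upwards [ae_spin_nonneg] with z hz
  exact not_le.2 (ht.trans_le (total_nonneg hz k))

/-- The volume of a simplex, by conditioning on the last spin; for t ≤ 1 the bound 1 on the spins
plays no role. -/
theorem measure_total_le (k : ℕ) {t : ℝ} (ht : t ∈ Icc (0 : ℝ) 1) :
    spinSeqLaw {z | total z k ≤ t} = ENNReal.ofReal (t ^ k / k.factorial) := by
  induction k generalizing t with
  | zero => simp [total, ht.1]
  | succ k ih =>
    have hS : MeasurableSet {q : ℝ × ℝ | q.1 + q.2 ≤ t} :=
      measurableSet_le (measurable_fst.add measurable_snd) measurable_const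
    have h := measure_total_spin_symm k hS
    simp only [mem_ofPred_eq, ← total_succ] at h
    rw [h]
    have h1 : ∀ x ∈ Icc (0 : ℝ) 1, spinSeqLaw {z | total z k + x ≤ t} =
        (Icc 0 t).indicator (fun x => ENNReal.ofReal ((t - x) ^ k / k.factorial)) x := by
      intro x hx
      simp only [← le_sub_iff_add_le]
      by_cases hxt : x ≤ t
      · rw [indicator_of_mem (show x ∈ Icc 0 t from ⟨hx.1, hxt⟩), ih ⟨by linarith, by linarith [hx.1, ht.2]⟩]
      · rw [indicator_of_notMem fun h => hxt h.2, measure_total_le_of_neg _ (by linarith)]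
    rw [spinLaw, setLIntegral_congr_fun measurableSet_Icc h1, lintegral_indicator measurableSet_Icc,
      Measure.restrict_restrict measurableSet_Icc,
      inter_eq_left.2 (Icc_subset_Icc_right ht.2)]
    have hc : Continuous fun x : ℝ => (t - x) ^ k / (k.factorial : ℝ) := by fun_prop
    rw [← ofReal_integral_eq_lintegral_ofReal (hc.integrableOn_Icc)
      ((ae_restrict_iff' measurableSet_Icc).2 (ae_of_all _ fun x hx =>
        div_nonneg (pow_nonneg (sub_nonneg.2 hx.2) _) (Nat.cast_nonneg _))),
      integral_Icc_eq_integral_Ioc, ← intervalIntegral.integral_of_le ht.1,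
      intervalIntegral.integral_div, intervalIntegral.integral_comp_sub_left (fun x => x ^ k) t,
      sub_self, sub_zero, integral_pow, Nat.factorial_succ]
    congr 1
    push_cast
    field_simp
    simp

/-- Given the earlier spins, a single value of the last one produces the total 1. -/
theorem ae_total_ne_one : ∀ᵐ z ∂spinSeqLaw, ∀ k, total z k ≠ 1 := by
  refine ae_all_iff.2 fun k => ?_
  cases k with
  | zero => simp [total]
  | succ k =>
    have hS : MeasurableSet {q : ℝ × ℝ | q.1 + q.2 = 1} :=
      measurableSet_eq_fun (measurable_fst.add measurable_snd) measurable_const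
    have h := measure_total_spin k hS
    simp only [mem_ofPred_eq, ← total_succ] at h
    refine measure_eq_zero_iff_ae_notMem.1 (h.trans ?_)
    have h0 : ∀ y : ℝ, spinLaw {x | y + x = 1} = 0 := fun y => by
      have : {x : ℝ | y + x = 1} = {1 - y} := by
        ext x
        simp only [mem_ofPred_eq, mem_singleton_iff]
        constructor <;> intro <;> linarith
      rw [this, spinLaw]
      exact measure_singleton _
    simp [h0]

/-! ### The law of the score -/

open Classical in
-- Joint measurability is needed because thresholds depend on earlier random scores.
theorem measurable_score : Measurable fun q : ℝ × (ℕ → ℝ) => score q.1 q.2 := by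
  have ht : ∀ k, Measurable fun q : ℝ × (ℕ → ℝ) => total q.2 k := fun k =>
    (measurable_total k).comp measurable_snd
  -- The second alternative makes the search terminate when the total never crosses; there `f` gives
  -- 0, as `score` does.
  set P : ℕ → ℝ × (ℕ → ℝ) → Prop := fun k q => q.1 < total q.2 k ∨ ∀ j, total q.2 j ≤ q.1
  have hP : ∀ q, ∃ k, P k q := by
    intro q
    by_cases h : ∀ j, total q.2 j ≤ q.1
    · exact ⟨0, Or.inr h⟩
    · push Not at h
      exact ⟨h.choose, Or.inl h.choose_spec⟩
  set f : ℕ → ℝ × (ℕ → ℝ) → ℝ := fun k q =>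
    if q.1 < total q.2 k ∧ total q.2 k ≤ 1 then total q.2 k else 0
  have hf : ∀ k, Measurable (f k) := fun k =>
    Measurable.ite ((measurableSet_lt measurable_fst (ht k)).inter
      (measurableSet_le (ht k) measurable_const)) (ht k) measurable_const
  have hPm : ∀ k, MeasurableSet {q | P k q} := by
    intro k
    refine (measurableSet_lt measurable_fst (ht k)).union ?_
    have : {q : ℝ × (ℕ → ℝ) | ∀ j, total q.2 j ≤ q.1} =
        ⋂ j, {q : ℝ × (ℕ → ℝ) | total q.2 j ≤ q.1} := by ext; simp
    change MeasurableSet {q : ℝ × (ℕ → ℝ) | ∀ j, total q.2 j ≤ q.1}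
    rw [this]
    exact MeasurableSet.iInter fun j => measurableSet_le (ht j) measurable_fst
  convert Measurable.find hf hPm hP using 1
  ext q
  unfold score
  split_ifs with h h1
  · have hfind : Nat.find (hP q) = Nat.find h := Nat.find_congr' fun {n} =>
      ⟨fun h2 => h2.resolve_right fun h3 => not_lt.2 (h3 _) h.choose_spec, Or.inl⟩
    rw [hfind]
    exact (if_pos ⟨Nat.find_spec h, h1⟩).symm
  · have hfind : Nat.find (hP q) = Nat.find h := Nat.find_congr' fun {n} =>
      ⟨fun h2 => h2.resolve_right fun h3 => not_lt.2 (h3 _) h.choose_spec, Or.inl⟩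
    rw [hfind]
    exact (if_neg fun h2 => h1 h2.2).symm
  · exact (if_neg fun h2 => h ⟨_, h2.1⟩).symm

theorem measurable_score_left (τ : ℝ) : Measurable (score τ) :=
  measurable_score.comp measurable_prodMk_left

/-- Totals are monotone, so the first crossing is seen from two consecutive totals alone, without a
search. -/
theorem score_mem_iff {τ : ℝ} (hτ : 0 ≤ τ) {B : Set ℝ} (hB : B ⊆ Ioc τ 1) {z : ℕ → ℝ}
    (hz : ∀ i, 0 ≤ z i) :
    score τ z ∈ B ↔ ∃ k, total z k ≤ τ ∧ total z k + z k ∈ B := by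
  classical
  have h0 : (0 : ℝ) ∉ B := fun h => not_lt.2 hτ (hB h).1
  simp only [← total_succ]
  constructor
  · intro h
    unfold score at h
    split_ifs at h with h1 h2
    · obtain ⟨k, hk⟩ : ∃ k, Nat.find h1 = k + 1 := by
        refine Nat.exists_eq_succ_of_ne_zero fun h3 => ?_
        have := Nat.find_spec h1
        rw [h3] at this
        simp only [total, Finset.range_zero, Finset.sum_empty] at this
        exact not_lt.2 hτ this
      rw [hk] at h
      exact ⟨k, not_lt.1 (Nat.find_min h1 (by omega)), h⟩
    · exact absurd h h0
    · exact absurd h h0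
  · rintro ⟨k, hk, hB'⟩
    have h1 := hB hB'
    have h2 : ∃ k, τ < total z k := ⟨k + 1, h1.1⟩
    have hfind : Nat.find h2 = k + 1 := (Nat.find_eq_iff h2).2
      ⟨h1.1, fun j hj => not_lt.2 ((monotone_total hz (Nat.lt_succ_iff.1 hj)).trans hk)⟩
    rw [score, dif_pos h2, hfind, if_pos h1.2]
    exact hB'

/-- For a total y in [0, τ] the translate B - y stays inside [0, 1], so the next spin hits it with
probability `volume B`, whatever y is. -/
theorem measure_crossing (k : ℕ) {τ : ℝ} {B : Set ℝ} (hB : B ⊆ Ioc τ 1) (hBm : MeasurableSet B) :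
    spinSeqLaw {z | total z k ≤ τ ∧ total z k + z k ∈ B} =
      volume B * spinSeqLaw {z | total z k ≤ τ} := by
  have hS : MeasurableSet {q : ℝ × ℝ | q.1 ≤ τ ∧ q.1 + q.2 ∈ B} :=
    (measurableSet_le measurable_fst measurable_const).inter
      ((measurable_fst.add measurable_snd) hBm)
  have h := measure_total_spin k hS
  simp only [mem_ofPred_eq] at h
  have hm : MeasurableSet {z | total z k ≤ τ} :=
    measurableSet_le (measurable_total k) measurable_const
  rw [h, ← setLIntegral_const, ← lintegral_indicator hm]
  refine lintegral_congr_ae ?_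
  filter_upwards [ae_spin_nonneg] with z hz
  by_cases hk : total z k ≤ τ
  · rw [indicator_of_mem (show z ∈ {z | total z k ≤ τ} from hk)]
    simp only [hk, true_and]
    change spinLaw ((fun x => total z k + x) ⁻¹' B) = _
    rw [spinLaw, Measure.restrict_apply ((measurable_const_add _) hBm), inter_eq_left.2,
      measure_preimage_add]
    intro x hx
    have h1 := hB hx
    have h2 := total_nonneg hz k
    exact ⟨by linarith [h1.1], by linarith [h1.2]⟩
  · rw [indicator_of_notMem (show z ∉ {z | total z k ≤ τ} from hk)]
    simp [hk]

/-- Crossings at different spins are almost surely disjoint, and the probabilities τ^k / k! sum to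
e^τ. -/
theorem measure_score_mem {τ : ℝ} (hτ : τ ∈ Icc (0 : ℝ) 1) {B : Set ℝ} (hB : B ⊆ Ioc τ 1)
    (hBm : MeasurableSet B) :
    spinSeqLaw {z | score τ z ∈ B} = ENNReal.ofReal (Real.exp τ) * volume B := by
  have h1 : {z | score τ z ∈ B} =ᵐ[spinSeqLaw]
      ⋃ k, {z | total z k ≤ τ ∧ total z k + z k ∈ B} := by
    refine Filter.eventuallyEq_set.2 ?_
    filter_upwards [ae_spin_nonneg] with z hz
    simpa using score_mem_iff hτ.1 hB hz
  have hdisj : ∀ j k : ℕ, j < k → AEDisjoint spinSeqLaw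
      {z | total z j ≤ τ ∧ total z j + z j ∈ B} {z | total z k ≤ τ ∧ total z k + z k ∈ B} := by
    intro j k hjk
    refine measure_eq_zero_iff_ae_notMem.2 ?_
    filter_upwards [ae_spin_nonneg] with z hz
    rintro ⟨hj, hk⟩
    have h2 := (hB hj.2).1
    rw [← total_succ] at h2
    exact not_lt.2 hk.1 (h2.trans_le (monotone_total hz hjk))
  rw [measure_congr h1, measure_iUnion₀]
  · simp only [measure_crossing _ hB hBm, measure_total_le _ hτ]
    rw [ENNReal.tsum_mul_left, ← ENNReal.ofReal_tsum_of_nonneg (fun k => by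
      have := hτ.1; positivity) (Real.summable_pow_div_factorial τ), mul_comm, Real.exp_eq_exp_ℝ,
      NormedSpace.exp_eq_tsum_div]
  · intro j k hjk
    rcases lt_or_gt_of_ne hjk with h | h
    · exact hdisj j k h
    · exact (hdisj k j h).symm
  · intro k
    exact ((measurableSet_le (measurable_total k) measurable_const).inter
      (((measurable_total k).add (measurable_pi_apply k)) hBm)).nullMeasurableSet

theorem measure_score_notMem {τ : ℝ} (hτ : τ ∈ Icc (0 : ℝ) 1) :
    spinSeqLaw {z | score τ z ∉ Ioc τ 1} = ENNReal.ofReal (p τ) := by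
  have h := prob_compl_eq_one_sub (μ := spinSeqLaw)
    (measurable_score_left τ (measurableSet_Ioc (a := τ) (b := 1)))
  have h1 : spinSeqLaw (score τ ⁻¹' Ioc τ 1) = ENNReal.ofReal (Real.exp τ) * volume (Ioc τ 1) :=
    measure_score_mem hτ subset_rfl measurableSet_Ioc
  rw [h1, Real.volume_Ioc, ← ENNReal.ofReal_mul (Real.exp_pos _).le, ← ENNReal.ofReal_one,
    ← ENNReal.ofReal_sub _ (mul_nonneg (Real.exp_pos _).le (sub_nonneg.2 hτ.2))] at h
  refine h.trans (congrArg _ ?_)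
  rw [p]
  ring

/-- The law of the score of a player with threshold `τ`. -/
theorem map_score {τ : ℝ} (hτ : τ ∈ Icc (0 : ℝ) 1) :
    spinSeqLaw.map (score τ) = ENNReal.ofReal (p τ) • Measure.dirac 0 +
      ENNReal.ofReal (Real.exp τ) • volume.restrict (Ioc τ 1) := by
  ext B hB
  rw [Measure.map_apply (measurable_score_left τ) hB,
    ← measure_inter_add_sdiff _ (measurable_score_left τ measurableSet_Ioc), ← preimage_inter]
  have h1 : spinSeqLaw (score τ ⁻¹' (B ∩ Ioc τ 1)) = _ :=
    measure_score_mem hτ inter_subset_right (hB.inter measurableSet_Ioc)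
  rw [h1, add_comm]
  simp only [Measure.coe_add, Measure.coe_smul, Pi.add_apply, Pi.smul_apply, smul_eq_mul,
    Measure.restrict_apply hB, Measure.dirac_apply' _ hB]
  congr 1
  rw [← measure_score_notMem hτ]
  by_cases h0 : (0 : ℝ) ∈ B
  · rw [indicator_of_mem h0, Pi.one_apply, mul_one]
    congr 1
    ext z
    simp only [mem_sdiff, mem_preimage, mem_ofPred_eq, and_iff_right_iff_imp]
    intro h
    rwa [(score_mem τ z).resolve_right h]
  · rw [indicator_of_notMem h0, mul_zero]
    convert measure_empty (μ := spinSeqLaw)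
    refine eq_empty_of_forall_notMem fun z hz => h0 ?_
    rw [← (score_mem τ z).resolve_right hz.2]
    exact hz.1

theorem lintegral_score {τ : ℝ} (hτ : τ ∈ Icc (0 : ℝ) 1) {f : ℝ → ENNReal} (hf : Measurable f) :
    ∫⁻ z, f (score τ z) ∂spinSeqLaw =
      ENNReal.ofReal (p τ) * f 0 + ENNReal.ofReal (Real.exp τ) * ∫⁻ s in Ioc τ 1, f s := by
  rw [← lintegral_map hf (measurable_score_left τ), map_score hτ, lintegral_add_measure,
    lintegral_smul_measure, lintegral_smul_measure, lintegral_dirac' _ hf, smul_eq_mul, smul_eq_mul]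

/-! ### Probabilities of the events -/

instance (r : ℕ) : IsProbabilityMeasure (spinsLaw r) := by unfold spinsLaw; infer_instance

theorem ae_spins_total_ne_one (r : ℕ) : ∀ᵐ z ∂spinsLaw r, ∀ i k, total (z i) k ≠ 1 := by
  refine ae_all_iff.2 fun i => ?_
  exact (measurePreserving_eval (fun _ : Fin r => spinSeqLaw) i).quasiMeasurePreserving.ae
    ae_total_ne_one

theorem spinsLaw_succ {r : ℕ} {T : Set ((ℕ → ℝ) × (Fin r → ℕ → ℝ))} (hT : MeasurableSet T) :
    spinsLaw (r + 1) {z | (z 0, fun i => z (Fin.succ i)) ∈ T} =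
      ∫⁻ y, spinsLaw r {w | (y, w) ∈ T} ∂spinSeqLaw := by
  have h := measurePreserving_piFinSuccAbove (fun _ : Fin (r + 1) => spinSeqLaw) 0
  have h1 := h.measure_preimage hT.nullMeasurableSet
  rw [Measure.prod_apply hT] at h1
  exact h1

/-- Conditioning on the next score; its atom and its density give the two terms of the recursions.
-/
theorem spinsLaw_succ_score {r : ℕ} {S : Set (ℝ × (Fin r → ℕ → ℝ))} (hS : MeasurableSet S) {τ : ℝ}
    (hτ : τ ∈ Icc (0 : ℝ) 1) :
    spinsLaw (r + 1) {z | (score τ (z 0), fun i => z (Fin.succ i)) ∈ S} =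
      ENNReal.ofReal (p τ) * spinsLaw r {w | (0, w) ∈ S} +
        ENNReal.ofReal (Real.exp τ) * ∫⁻ s in Ioc τ 1, spinsLaw r {w | (s, w) ∈ S} := by
  have hm : Measurable fun q : (ℕ → ℝ) × (Fin r → ℕ → ℝ) => (score τ q.1, q.2) :=
    ((measurable_score_left τ).comp measurable_fst).prodMk measurable_snd
  exact (spinsLaw_succ (hm hS)).trans (lintegral_score hτ (measurable_measure_prodMk_left hS))

theorem measurableSet_belowEvent (r : ℕ) :
    MeasurableSet {q : ℝ × (Fin r → ℕ → ℝ) | q.2 ∈ belowEvent r q.1} := by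
  have : {q : ℝ × (Fin r → ℕ → ℝ) | q.2 ∈ belowEvent r q.1} =
      ⋂ i : Fin r, {q | score (max (θ (r - i)) q.1) (q.2 i) < q.1} := by
    ext; simp [belowEvent]
  rw [this]
  exact MeasurableSet.iInter fun i => measurableSet_lt (measurable_score.comp
    ((measurable_const.max measurable_fst).prodMk ((measurable_pi_apply i).comp measurable_snd)))
    measurable_fst

theorem measurable_tail (r : ℕ) :
    Measurable fun z : Fin (r + 1) → ℕ → ℝ => fun i : Fin r => z i.succ :=
  measurable_pi_lambda _ fun i => measurable_pi_apply i.succ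

theorem measurableSet_winEvent (r m : ℕ) :
    MeasurableSet {q : ℝ × (Fin r → ℕ → ℝ) | q.2 ∈ winEvent r m q.1} := by
  induction r generalizing m with
  | zero => exact MeasurableSet.empty
  | succ r ih =>
    have hs : Measurable fun q : ℝ × (Fin (r + 1) → ℕ → ℝ) =>
        score (max (θ (r + 1)) q.1) (q.2 0) := measurable_score.comp
      ((measurable_const.max measurable_fst).prodMk ((measurable_pi_apply 0).comp measurable_snd))
    have ht : Measurable fun q : ℝ × (Fin (r + 1) → ℕ → ℝ) => fun i : Fin r => q.2 i.succ :=
      (measurable_tail r).comp measurable_snd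
    cases m with
    | zero =>
      exact (measurableSet_lt measurable_fst hs).inter
        ((hs.prodMk ht) (measurableSet_belowEvent r))
    | succ m => exact ((measurable_fst.max hs).prodMk ht) (ih m)

/-- All thresholds are at least `s > 0`, so a score below `s` is a bust, and the busts are
independent. -/
theorem measure_belowEvent (r : ℕ) {s : ℝ} (hs : s ∈ Ioc (0 : ℝ) 1) :
    spinsLaw r (belowEvent r s) = ENNReal.ofReal (probBelow r s) := by
  have h : belowEvent r s =
      univ.pi fun i : Fin r => {y | score (max (θ (r - i)) s) y ∉ Ioc (max (θ (r - i)) s) 1} := by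
    ext z
    simp only [belowEvent, mem_ofPred_eq, mem_univ_pi]
    refine forall_congr' fun i => ⟨fun h h1 => ?_, fun h => ?_⟩
    · exact not_lt.2 (le_max_right _ _) (h1.1.trans h)
    · rw [(score_mem _ _).resolve_right h]
      exact hs.1
  rw [h, probBelow, ENNReal.ofReal_prod_of_nonneg fun i _ => p_nonneg (max_theta_mem _ hs.2)]
  refine (Measure.pi_pi _ _).trans (Finset.prod_congr rfl fun i _ => ?_)
  exact measure_score_notMem (max_theta_mem _ hs.2)

theorem lintegral_Ioc_ofReal {G : ℝ → ℝ} (hG : Continuous G) {a : ℝ} (ha : a ≤ 1)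
    (h0 : ∀ s ≤ 1, 0 ≤ G s) :
    ∫⁻ s in Ioc a 1, ENNReal.ofReal (G s) = ENNReal.ofReal (∫ s in a..1, G s) := by
  rw [intervalIntegral.integral_of_le ha, ofReal_integral_eq_lintegral_ofReal
    (hG.integrableOn_Icc.mono_set Ioc_subset_Icc_self)]
  exact (ae_restrict_iff' measurableSet_Ioc).2 (ae_of_all _ fun x hx => h0 x hx.2)

/-- The threshold is arbitrary here, so that deviations from the policy are covered. A bust
contributes nothing, since 0 never exceeds `M`. -/
theorem measure_nextEvent (r : ℕ) {τ M : ℝ} (hτ : τ ∈ Icc (0 : ℝ) 1) (hM : M ∈ Icc (0 : ℝ) 1) :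
    spinsLaw (r + 1) (nextEvent r τ M) =
      ENNReal.ofReal (Real.exp τ * ∫ s in (max τ M)..1, probBelow r s) := by
  have hS : MeasurableSet {q : ℝ × (Fin r → ℕ → ℝ) | M < q.1 ∧ q.2 ∈ belowEvent r q.1} :=
    (measurableSet_lt measurable_const measurable_fst).inter (measurableSet_belowEvent r)
  refine (spinsLaw_succ_score hS hτ).trans ?_
  have h0 : {w : Fin r → ℕ → ℝ | M < (0, w).1 ∧ (0, w).2 ∈ belowEvent r (0, w).1} = ∅ :=
    eq_empty_of_forall_notMem fun w hw => not_lt.2 hM.1 hw.1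
  have h1 : ∀ s ∈ Ioc τ 1, spinsLaw r {w | M < s ∧ w ∈ belowEvent r s} =
      (Ioi M).indicator (fun s => ENNReal.ofReal (probBelow r s)) s := by
    intro s hs
    by_cases hMs : M < s
    · rw [indicator_of_mem (mem_Ioi.2 hMs), ← measure_belowEvent r ⟨hτ.1.trans_lt hs.1, hs.2⟩]
      simp [hMs]
    · rw [indicator_of_notMem (by simpa using hMs)]
      simp [hMs]
  simp only [mem_ofPred_eq] at h0 ⊢
  rw [h0, measure_empty, mul_zero, zero_add, setLIntegral_congr_fun measurableSet_Ioc h1,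
    setLIntegral_indicator measurableSet_Ioi, inter_comm, Ioc_inter_Ioi,
    lintegral_Ioc_ofReal (continuous_probBelow r) (max_le hτ.2 hM.2) fun s => probBelow_nonneg r,
    ENNReal.ofReal_mul (Real.exp_pos _).le]

theorem measure_winEvent {r m : ℕ} (hm : m < r) {M : ℝ} (hM : M ∈ Icc (0 : ℝ) 1) :
    spinsLaw r (winEvent r m M) = ENNReal.ofReal (winValue r m M) := by
  induction r generalizing m M with
  | zero => omega
  | succ r ih =>
    have hτ := max_theta_mem (r + 1) hM.2
    have hle : M ≤ max (θ (r + 1)) M := le_max_right _ _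
    cases m with
    | zero =>
      refine (measure_nextEvent r hτ hM).trans ?_
      rw [max_eq_left hle, winValue]
    | succ m =>
      have hS : MeasurableSet {q : ℝ × (Fin r → ℕ → ℝ) | q.2 ∈ winEvent r m (max M q.1)} :=
        ((measurable_const.max measurable_fst).prodMk measurable_snd)
          (measurableSet_winEvent r m)
      refine (spinsLaw_succ_score hS hτ).trans ?_
      have h1 : ∀ s ∈ Ioc (max (θ (r + 1)) M) 1, spinsLaw r {w | w ∈ winEvent r m (max M s)} =
          ENNReal.ofReal (winValue r m s) := by
        intro s hs
        rw [max_eq_right (hle.trans hs.1.le)]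
        exact ih (by omega) ⟨hτ.1.trans hs.1.le, hs.2⟩
      have h0 : spinsLaw r {w | w ∈ winEvent r m (max M 0)} =
          ENNReal.ofReal (winValue r m M) := by
        rw [max_eq_left hM.1]
        exact ih (by omega) hM
      simp only [mem_ofPred_eq]
      rw [h0, setLIntegral_congr_fun measurableSet_Ioc h1,
        lintegral_Ioc_ofReal (continuous_winValue r m) hτ.2 fun s => winValue_nonneg r m,
        ← ENNReal.ofReal_mul (p_nonneg hτ), ← ENNReal.ofReal_mul (Real.exp_pos _).le,
        ← ENNReal.ofReal_add (mul_nonneg (p_nonneg hτ) (winValue_nonneg r m hM.2))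
          (mul_nonneg (Real.exp_pos _).le (intervalIntegral.integral_nonneg hτ.2
            fun t ht => winValue_nonneg r m ht.2)), winValue]

/-! ### Winning probabilities -/

theorem winProb_maxPolicy {n r m : ℕ} {L : List ℝ} (hn : L.length + r = n) (hm : m < r)
    (hL : ∀ s ∈ L, s ∈ Icc (0 : ℝ) 1) :
    winProb n (maxPolicy n) L (L.length + m + 1) = winValue r m (maxScore L) := by
  have hM : maxScore L ∈ Icc (0 : ℝ) 1 := ⟨maxScore_nonneg L, maxScore_le_one hL⟩
  obtain rfl : r = n - L.length := by omega
  simp only [winProb, wins_play_iff_winEvent hn hm]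
  rw [measureReal_def]
  change (spinsLaw _ (winEvent _ m (maxScore L))).toReal = _
  rw [measure_winEvent hm hM, ENNReal.toReal_ofReal (winValue_nonneg _ _ hM.2)]

theorem winProb_update_maxPolicy {n r : ℕ} {L : List ℝ} (hn : L.length + (r + 1) = n)
    (hL : ∀ s ∈ L, s ∈ Icc (0 : ℝ) 1) {τ : ℝ} (hτ : τ ∈ Icc (0 : ℝ) 1) :
    winProb n (Function.update (maxPolicy n) L τ) L (L.length + 1) =
      Real.exp τ * ∫ s in (max τ (maxScore L))..1, probBelow r s := by
  have hM : maxScore L ∈ Icc (0 : ℝ) 1 := ⟨maxScore_nonneg L, maxScore_le_one hL⟩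
  have hr : n - L.length = r + 1 := by omega
  simp only [winProb]
  rw [hr]
  simp only [play_update, wins_play_append_iff hn]
  rw [measureReal_def]
  change (spinsLaw _ (nextEvent r τ (maxScore L))).toReal = _
  rw [measure_nextEvent r hτ hM, ENNReal.toReal_ofReal]
  exact mul_nonneg (Real.exp_pos _).le (intervalIntegral.integral_nonneg (max_le hτ.2 hM.2)
    fun t ht => probBelow_nonneg r ht.2)

/-- Almost surely no score equals 1, so the policies may differ after histories containing a 1. -/
theorem winProb_congr {n : ℕ} {σ σ' : Profile} {L : List ℝ} (hn : L.length ≤ n)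
    (hL : ∀ s ∈ L, s ∈ Icc (0 : ℝ) 1) (hL1 : maxScore L < 1)
    (h : ∀ L' : List ℝ, L <+: L' → L'.length < n → (∀ s ∈ L', s ∈ Icc (0 : ℝ) 1) →
      maxScore L' < 1 → 0 ≤ σ L' ∧ σ L' = σ' L') (m : ℕ) :
    winProb n σ L m = winProb n σ' L m := by
  refine measureReal_congr (Filter.eventuallyEq_set.2 ?_)
  filter_upwards [ae_spins_total_ne_one (n - L.length)] with z hz
  rw [play_congr_of_ne_one (by omega) hL hL1 h hz]

theorem winProb_eq_zero (n : ℕ) (σ : Profile) {L : List ℝ} (hL1 : maxScore L = 1) (m : ℕ) :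
    winProb n σ L (L.length + m + 1) = 0 := by
  simp [winProb, not_wins_of_maxScore_eq_one σ _ m hL1]

theorem exp_mul_integral_probBelow_lt (r : ℕ) {M τ : ℝ} (hM : 0 ≤ M) (hM1 : M < 1)
    (hτ : τ ∈ Icc (0 : ℝ) 1) (hne : τ ≠ max (θ (r + 1)) M) :
    (Real.exp τ * ∫ t in (max τ M)..1, probBelow r t) <
      Real.exp (max (θ (r + 1)) M) * ∫ t in (max (θ (r + 1)) M)..1, probBelow r t :=
  exp_mul_integral_lt (continuous_probBelow r) (monotoneOn_probBelow r)
    (fun _ hx => probBelow_pos r hx) (theta_mem _) (probBelow_theta r) hM hM1 hτ hne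

/-! ### Optimality, and uniqueness of optimal play -/

theorem isOptimal_maxPolicy (n : ℕ) : IsOptimal n (maxPolicy n) := by
  intro L hlen hL
  obtain ⟨r, hn⟩ : ∃ r, L.length + (r + 1) = n := ⟨n - L.length - 1, by omega⟩
  have hM1 := maxScore_le_one hL
  rw [maxPolicy_eq hn]
  refine ⟨max_theta_mem _ hM1, fun τ hτ => ?_⟩
  rcases hM1.eq_or_lt with h1 | h1
  · rw [winProb_eq_zero n _ h1 0, winProb_eq_zero n _ h1 0]
  have hval := winProb_maxPolicy hn (Nat.succ_pos r) hL
  rw [Nat.add_zero, winValue] at hval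
  rw [winProb_update_maxPolicy hn hL hτ, hval]
  by_cases hne : τ = max (θ (r + 1)) (maxScore L)
  · rw [hne, max_eq_left (le_max_right _ _)]
  · exact (exp_mul_integral_probBelow_lt r (maxScore_nonneg L) h1 hτ hne).le

/-- An optimal policy is unique, except after the histories with a score `1`. -/
theorem IsOptimal.eq_maxPolicy {n : ℕ} {σ : Profile} (hσ : IsOptimal n σ) {L : List ℝ}
    (hlen : L.length < n) (hL : ∀ s ∈ L, s ∈ Icc (0 : ℝ) 1) (hL1 : maxScore L < 1) :
    σ L = maxPolicy n L := by
  obtain ⟨r, hn⟩ : ∃ r, L.length + (r + 1) = n := ⟨n - L.length - 1, by omega⟩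
  -- Backward induction: once the later players are known to follow `maxPolicy`, the winning
  -- probability is an explicit function of the own threshold, with only one maximizer.
  induction r using Nat.strong_induction_on generalizing L with
  | _ r ih =>
    obtain ⟨hmem, hopt⟩ := hσ L hlen hL
    have hupdate : ∀ τ ∈ Icc (0 : ℝ) 1, winProb n (Function.update σ L τ) L (L.length + 1) =
        Real.exp τ * ∫ s in (max τ (maxScore L))..1, probBelow r s := by
      intro τ hτ
      rw [← winProb_update_maxPolicy hn hL hτ]
      refine winProb_congr hlen.le hL hL1 (fun L' hpre hlen' hL' hL1' => ?_) _
      by_cases heq : L' = L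
      · subst heq
        simp [hτ.1]
      · have hlt : L.length < L'.length := lt_of_le_of_ne hpre.length_le fun h =>
          heq (hpre.eq_of_length h).symm
        rw [Function.update_of_ne heq, Function.update_of_ne heq]
        exact ⟨(hσ L' hlen' hL').1.1,
          ih (n - L'.length - 1) (by omega) hlen' hL' hL1' (by omega)⟩
    by_contra hne
    rw [maxPolicy_eq hn] at hne
    have hT := max_theta_mem (r + 1) hL1.le
    have h1 := exp_mul_integral_probBelow_lt r (maxScore_nonneg L) hL1 hmem hne
    have h2 := hopt _ hT
    have h3 := hupdate _ hmem
    rw [Function.update_eq_self] at h3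
    rw [hupdate _ hT, h3, max_eq_left (le_max_right _ _)] at h2
    exact not_lt.2 h2 h1

theorem IsOptimal.winProb_eq {n r m : ℕ} {σ : Profile} (hσ : IsOptimal n σ) {L : List ℝ}
    (hn : L.length + r = n) (hm : m < r) (hL : ∀ s ∈ L, s ∈ Icc (0 : ℝ) 1) :
    winProb n σ L (L.length + m + 1) = winValue r m (maxScore L) := by
  rcases (maxScore_le_one hL).eq_or_lt with h1 | h1
  · rw [winProb_eq_zero n σ h1 m, h1, winValue_one]
  · rw [← winProb_maxPolicy hn hm hL]
    exact winProb_congr (by omega) hL h1 (fun L' _ hlen' hL' hL1' =>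
      ⟨(hσ L' hlen' hL').1.1, hσ.eq_maxPolicy hlen' hL' hL1'⟩) _

theorem IsOptimal.winProb_nil {n m : ℕ} {σ : Profile} (hσ : IsOptimal n σ) (hm : m < n) :
    winProb n σ [] (m + 1) = winValue n m 0 := by
  have h := hσ.winProb_eq (L := []) (by simp) hm (by simp)
  rw [List.length_nil, Nat.zero_add] at h
  exact h

end ShowcaseShowdown

end

theorem proposition5p5 :
    -- The policy with thresholds `max (θ r) M` is optimal.
    (∀ n : ℕ, 1 ≤ n → ShowcaseShowdown.IsOptimal n (ShowcaseShowdown.maxPolicy n)) ∧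
    -- Let `σ n` be an optimal policy for the game with `n` players, for every `n`.
    ∀ σ : ℕ → ShowcaseShowdown.Profile,
      (∀ n : ℕ, 1 ≤ n → ShowcaseShowdown.IsOptimal n (σ n)) →
      ∃ F : ℕ → ℕ → ℝ → ℝ,
        -- `F r m x` is the winning probability of player `n - r + m` in the game with `n` players,
        -- when the largest score of the first `n - r` players is `x ≥ θ r`.
        (∀ n r m : ℕ, 1 ≤ r → r < n → 1 ≤ m → m ≤ r →
          ∀ hist : List ℝ, hist.length = n - r → (∀ s ∈ hist, s ∈ Set.Icc (0 : ℝ) 1) →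
            ShowcaseShowdown.θ r ≤ ShowcaseShowdown.maxScore hist →
            ShowcaseShowdown.winProb n (σ n) hist (n - r + m) =
              F r m (ShowcaseShowdown.maxScore hist)) ∧
        (∀ r m : ℕ, 1 ≤ m → m ≤ r →
          IntervalIntegrable (F r m) MeasureTheory.volume (ShowcaseShowdown.θ r) 1) ∧
        -- The recursion for `F`.
        (∀ r : ℕ, 1 ≤ r → ∀ x ∈ Set.Icc (ShowcaseShowdown.θ r) 1,
          F r 1 x = Real.exp x * ∫ t in x..1, ShowcaseShowdown.p t ^ (r - 1)) ∧
        (∀ r m : ℕ, 2 ≤ m → m ≤ r → ∀ x ∈ Set.Icc (ShowcaseShowdown.θ r) 1,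
          F r m x = ShowcaseShowdown.p x * F (r - 1) (m - 1) x +
            Real.exp x * ∫ t in x..1, F (r - 1) (m - 1) t) ∧
        -- The winning probabilities in the whole game.
        (∀ n : ℕ, 1 ≤ n →
          ShowcaseShowdown.winProb n (σ n) [] 1 =
            Real.exp (ShowcaseShowdown.θ n) *
              ShowcaseShowdown.p (ShowcaseShowdown.θ n) ^ (n - 1)) ∧
        (∀ n m : ℕ, 2 ≤ m → m ≤ n →
          ShowcaseShowdown.winProb n (σ n) [] m =
            ShowcaseShowdown.p (ShowcaseShowdown.θ n) *
              ShowcaseShowdown.winProb (n - 1) (σ (n - 1)) [] (m - 1) +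
            Real.exp (ShowcaseShowdown.θ n) *
              ∫ t in (ShowcaseShowdown.θ n)..1, F (n - 1) (m - 1) t) := by
  open ShowcaseShowdown in
  -- `winValue` counts the remaining players from 0, hence the index `m - 1`.
  refine ⟨fun n _ => isOptimal_maxPolicy n, fun σ hσ =>
    ⟨fun r m => winValue r (m - 1), ?_, ?_, ?_, ?_, ?_, ?_⟩⟩
  · intro n r m hr hrn hm hmr hist hlen hhist _
    have h := (hσ n (by omega)).winProb_eq (L := hist) (r := r) (m := m - 1) (by omega) (by omega)
      hhist
    rwa [hlen, Nat.add_assoc, Nat.sub_add_cancel hm] at h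
  · intro r m _ _
    exact (continuous_winValue r (m - 1)).intervalIntegrable _ _
  · intro r hr x hx
    obtain ⟨r, rfl⟩ : ∃ k, r = k + 1 := ⟨r - 1, by omega⟩
    simp only [Nat.sub_self, winValue, Nat.add_sub_cancel]
    rw [max_eq_right hx.1, integral_probBelow hx]
  · intro r m hm hmr x hx
    obtain ⟨r, rfl⟩ : ∃ k, r = k + 1 := ⟨r - 1, by omega⟩
    obtain ⟨m, rfl⟩ : ∃ k, m = k + 2 := ⟨m - 2, by omega⟩
    simp only [Nat.add_sub_cancel, Nat.add_succ_sub_one, winValue]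
    rw [max_eq_right hx.1]
  · intro n hn
    obtain ⟨n, rfl⟩ : ∃ k, n = k + 1 := ⟨n - 1, by omega⟩
    -- At the start the maximum is 0 and the threshold is θ itself, whose defining equation turns
    -- the integral into a power of `p`.
    rw [(hσ (n + 1) hn).winProb_nil (m := 0) (by omega), winValue,
      max_eq_left (theta_mem (n + 1)).1, integral_probBelow ⟨le_rfl, (theta_mem (n + 1)).2⟩,
      theta_spec (n + 1), Nat.add_sub_cancel]
  · intro n m hm hmn
    obtain ⟨n, rfl⟩ : ∃ k, n = k + 1 := ⟨n - 1, by omega⟩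
    obtain ⟨m, rfl⟩ : ∃ k, m = k + 2 := ⟨m - 2, by omega⟩
    have h := (hσ n (by omega)).winProb_nil (m := m) (by omega)
    simp only [Nat.add_sub_cancel, Nat.add_succ_sub_one]
    -- A bust of the first player leaves the maximum at 0, which is a fresh game with one player
    -- fewer.
    rw [(hσ (n + 1) (by omega)).winProb_nil (m := m + 1) (by omega), h, winValue,
      max_eq_left (theta_mem (n + 1)).1]
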